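/- A multipass pairing heap is a heap-ordered multi-ary tree; delete-min removes its root and combines the $k$ children of the root, ordered from left to right, into a single tree by repeated pairing rounds. In one round, with top-level nodes $x_1,\dots,x_\ell$, the nodes $x_{2i-1}$ and $x_{2i}$ are linked for $1\le i\le\lfloor \ell/2\rfloor$, where linking makes the node with the larger key the leftmost child of the other one (if $\ell$ is odd, $x_\ell$ is unaffected). The real cost of the operation is $k$, and $\log$ is to base $2$. For a heap $T$ consider its binary tree view (left child = leftmost child, right child = next sibling), where every absent child is regarded as an external node of size $1$, let $s(x)$ be the size of the subtree rooted at $x$ (so $s(x)=s(x.\mathsf{left})+s(x.\mathsf{right})+1$ for a node of the heap) and $$\Phi(T)=\sum_{x}\frac{H(x)}{\log^2(2+H(x))},\qquad H(x)=\log\frac{s(p(x))}{s(x)},$$ the sum being over all nodes $x$ (external ones included) that have a parent $p(x)$; $\Phi=0$ for the empty heap. Theorem. In multipass pairing heaps, delete-min takes amortized time $O(\log n\cdot\log^* n\cdot 2^{\log^* n})$ on a heap with $n$ nodes, with respect to the potential $\Phi$ scaled by a constant multiple of $2^{\log^* n}$. That is, there are absolute constants $c,C>0$ such that, with $\Psi(T)=c\cdot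 2^{\log^* |T|}\cdot\Phi(T)$, where $|T|$ is the number of nodes of $T$, every delete-min on a heap $T$ with $n\ge 1$ nodes, of real cost $k$ and with resulting heap $T'$, satisfies $$k+\Psi(T')-\Psi(T)\le C\cdot\log n\cdot\log^* n\cdot 2^{\log^* n}.$$ Consequently, for every heap $T$ with $n$ nodes and every $m\le n$, the total real cost of $m$ successive delete-min operations starting from $T$ is at most $\Psi(T)+\sum_{i=0}^{m-1} C\cdot\log(n-i)\cdot\log^*(n-i)\cdot 2^{\log^*(n-i)}$. -/

import Mathlib

noncomputable section

namespace PairingHeap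

universe u

variable {α : Type u}

/-! ### Multi-ary heaps in the binary tree view

An ordered forest (a list of multi-ary trees with keys in the nodes) is stored as a binary tree:
the left child of a node is its leftmost child, the right child is its next sibling.  So
`BinaryTree.nil` is the empty forest, and `BinaryTree.node x A C` is the forest whose first tree
has a root with key `x` and the forest `A` below it, followed by the forest `C` of the remaining
trees. -/

/-- The keys of the top-level nodes of a forest, from left to right. -/
def topKeys : BinaryTree α → List α
  | .nil => []
  | .node x _ C => x :: topKeys C

/-- The number of top-level nodes of a forest. -/
def numRoots (F : BinaryTree α) : ℕ := (topKeys F).length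

/-- The heap condition for a forest: no node has a larger key than one of its children. -/
def HeapOrdered [LE α] : BinaryTree α → Prop
  | .nil => True
  | .node x A C => (∀ y ∈ topKeys A, x ≤ y) ∧ HeapOrdered A ∧ HeapOrdered C

/-- A pairing heap is a heap-ordered multi-ary tree (possibly empty), that is, a heap-ordered
forest with at most one top-level node. -/
def IsPairingHeap [LE α] (T : BinaryTree α) : Prop := HeapOrdered T ∧ numRoots T ≤ 1

/-! ### The operation delete-min -/

/-- One pairing round on the forest of trees `x₁, …, x_ℓ`: for `1 ≤ i ≤ ⌊ℓ/2⌋` the trees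
`x_{2i-1}` and `x_{2i}` are linked, which makes the root with the larger key the leftmost child of
the other one.  If `ℓ` is odd, the last tree is unaffected. -/
def pairingRound [LinearOrder α] : BinaryTree α → BinaryTree α
  | .node x A (.node y B C) =>
      if x ≤ y then .node x (.node y B A) (pairingRound C)
      else .node y (.node x A B) (pairingRound C)
  | .node x A .nil => .node x A .nil
  | .nil => .nil

theorem numRoots_pairingRound [LinearOrder α] (F : BinaryTree α) :
    numRoots (pairingRound F) = (numRoots F + 1) / 2 := by
  induction F using pairingRound.induct with
  | case1 x A y B C h ih =>
    simp only [numRoots, topKeys, pairingRound, if_pos h, List.length_cons] at ih ⊢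
    omega
  | case2 x A y B C h ih =>
    simp only [numRoots, topKeys, pairingRound, if_neg h, List.length_cons] at ih ⊢
    omega
  | case3 x A => simp [numRoots, topKeys, pairingRound]
  | case4 => simp [numRoots, topKeys, pairingRound]

/-- Pairing rounds are repeated until at most one top-level node is left. -/
def multipass [LinearOrder α] (F : BinaryTree α) : BinaryTree α :=
  if numRoots F ≤ 1 then F else multipass (pairingRound F)
termination_by numRoots F
decreasing_by
  rw [numRoots_pairingRound]
  omega

/-- Delete-min in a multipass pairing heap: the root is deleted, and its children are combined
into a single tree by pairing rounds. -/
def deleteMin [LinearOrder α] : BinaryTree α → BinaryTree α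
  | .nil => .nil
  | .node _ F _ => multipass F

/-- The real cost of delete-min: the number `k` of children of the deleted root (the number of
links performed is `k - 1` if `k ≥ 1`). -/
def deleteMinCost : BinaryTree α → ℕ
  | .nil => 0
  | .node _ F _ => numRoots F

/-! ### The potential -/

/-- The size of a subtree of the binary tree view, where an absent child counts as an external
node of size `1`. -/
def extSize : BinaryTree α → ℕ
  | .nil => 1
  | .node _ L R => extSize L + extSize R + 1

/-- The potential `H / log²(2 + H)`, where `H = log (s / t)`, of a node with subtree size `t`
whose parent has subtree size `s`. -/
def nodePotential (s t : ℕ) : ℝ :=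
  Real.logb 2 ((s : ℝ) / (t : ℝ)) / (Real.logb 2 (2 + Real.logb 2 ((s : ℝ) / (t : ℝ)))) ^ 2

/-- The potential `Φ`: the sum of the potentials of all nodes (external ones included) that have
a parent in the binary tree view. -/
def potential : BinaryTree α → ℝ
  | .nil => 0
  | .node x L R =>
      nodePotential (extSize (.node x L R)) (extSize L)
        + nodePotential (extSize (.node x L R)) (extSize R)
        + potential L + potential R

/-- The iterated logarithm `log* x` to base `2`: the least number of times that the logarithm has
to be applied, starting from `x`, to reach a value that is at most `1`. -/
def logStar (x : ℝ) : ℕ := sInf {i : ℕ | (Real.logb 2)^[i] x ≤ 1}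

/-- The scaled potential `c · 2^(log* n) · Φ`, where `n` is the number of nodes of the heap. -/
def scaledPotential (c : ℝ) (T : BinaryTree α) : ℝ :=
  c * 2 ^ logStar (T.numNodes : ℝ) * potential T

/-- The amortized time of delete-min on the heap `T` with respect to the potential `Ψ`: the real
cost plus the increase of the potential. -/
def amortizedTime [LinearOrder α] (Ψ : BinaryTree α → ℝ) (T : BinaryTree α) : ℝ :=
  (deleteMinCost T : ℝ) + (Ψ (deleteMin T) - Ψ T)

/-- The function `log n · log* n · 2^(log* n)`. -/
def rate (n : ℕ) : ℝ := Real.logb 2 (n : ℝ) * (logStar (n : ℝ) : ℝ) * 2 ^ logStar (n : ℝ)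

end PairingHeap

end

namespace PairingHeap

open Real

/-! Link two neighbours with left subtrees of sizes `a`, `b`, followed by a forest of size `c`; put
`s = a + b + c + 2`. Write `damped` for the potential as a function of `H`. It is increasing and
subadditive, and its slope up to `y` is at least `1 / (8 log²(2 + y))`. Two facts about one link
carry the proof.

Loss: the potential grows by at most a constant times `damped (log (s / c))`
(`linkIncrease_le_lossConst`). As `damped h ≤ h`, these bounds telescope along the spine, so a round
loses `O(log n)`. When there are at most `2^(-i) log n` links to spare, `damped h ≤ 16 (2^i + h) /
i²` improves this to `O(log n / i²)`, which is summable over the remaining rounds.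

Gain: if both linked nodes have `H ≤ h` but the left child of the winner gets `H` above `shrink h =
O(log² h)`, the potential drops by at least `1` (`linkIncrease_le_neg_one`). Hence potential plus
number of high roots, with the threshold passing from `h` to `shrink h`, grows in a round by at most
the loss. Initially `h` exceeds the log-size and no root is high; after about `log* n` rounds the
threshold is a constant, and only `O(log n)` roots can be low. So the potential has dropped by `k /
2^r - O(r log n)` with `r = log* n - 1`.

While `k` is large, a phase of `r + 1` rounds thus pays for its own losses and, if it is the first,
for the scaled cost `k / 2^(r+1)`. Once `k ≤ 2^O(log* n) log n`, another `O(log* n)` rounds at loss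
`O(log n)` lead to the summable regime. Scaling by `2^(log* n)` gives the bound
(`potential_multipass_add_le`). -/

/-! ### The function `h / log²(2 + h)`. -/

/-- The function `h / log²(2 + h)`. -/
noncomputable def damped (h : ℝ) : ℝ := h / (logb 2 (2 + h)) ^ 2

theorem nodePotential_eq (s t : ℕ) :
    nodePotential s t = damped (logb 2 ((s : ℝ) / (t : ℝ))) := rfl

theorem one_le_logb_two_add {h : ℝ} (hh : 0 ≤ h) : 1 ≤ logb 2 (2 + h) := by
  rw [Real.le_logb_iff_rpow_le (by norm_num) (by linarith)]
  simpa using hh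

theorem logb_two_mono {x y : ℝ} (hx : 0 < x) (hxy : x ≤ y) : logb 2 x ≤ logb 2 y :=
  Real.logb_le_logb_of_le (by norm_num) hx hxy

theorem damped_nonneg {h : ℝ} (hh : 0 ≤ h) : 0 ≤ damped h := by
  unfold damped; positivity

theorem damped_le_self {h : ℝ} (hh : 0 ≤ h) : damped h ≤ h :=
  div_le_self hh (one_le_pow₀ (one_le_logb_two_add hh))

theorem damped_add_le {x y : ℝ} (hx : 0 ≤ x) (hy : 0 ≤ y) :
    damped (x + y) ≤ damped x + damped y := by
  have hx1 := one_le_logb_two_add hx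
  have hy1 := one_le_logb_two_add hy
  unfold damped
  rw [add_div]
  gcongr <;> linarith

theorem hasDerivAt_damped {h : ℝ} (hh : 0 ≤ h) :
    HasDerivAt damped ((1 * (logb 2 (2 + h)) ^ 2 -
      h * (2 * logb 2 (2 + h) * (1 / (2 + h) / Real.log 2))) / ((logb 2 (2 + h)) ^ 2) ^ 2) h := by
  have h1 := one_le_logb_two_add hh
  have h2 : HasDerivAt (fun x : ℝ => 2 + x) 1 h := by
    simpa using (hasDerivAt_id h).const_add 2
  have h3 : HasDerivAt (fun x : ℝ => logb 2 (2 + x)) (1 / (2 + h) / Real.log 2) h :=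
    (h2.log (by positivity)).div_const _
  have h4 := h3.pow 2
  have h5 := (hasDerivAt_id h).div h4 (pow_ne_zero 2 (zero_lt_one.trans_le h1).ne')
  refine (show HasDerivAt damped _ h from h5).congr_deriv ?_
  simp

theorem le_deriv_damped {h y : ℝ} (hh : 0 ≤ h) (hy : h ≤ y) :
    1 / (8 * (logb 2 (2 + y)) ^ 2) ≤ (1 * (logb 2 (2 + h)) ^ 2 -
      h * (2 * logb 2 (2 + h) * (1 / (2 + h) / Real.log 2))) / ((logb 2 (2 + h)) ^ 2) ^ 2 := by
  have h1 := one_le_logb_two_add hh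
  have hm : logb 2 (2 + h) ≤ logb 2 (2 + y) := logb_two_mono (by linarith) (by linarith)
  -- The negative term of the derivative is at most `7/8` of the positive one; this leaves the
  -- factor `1/8`. The logarithm is bounded below by its tangent-type estimate at `2 + h = 4`.
  have key : 2 * (h * (1 / (2 + h) / Real.log 2)) ≤ 7 / 8 * logb 2 (2 + h) := by
    have hl2 : 0 < Real.log 2 := Real.log_pos (by norm_num)
    have hl := Real.log_two_gt_d9
    have h4 : Real.log 4 = 2 * Real.log 2 := by
      rw [show (4 : ℝ) = 2 ^ 2 by norm_num, Real.log_pow]; norm_num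
    have h5 := Real.one_sub_inv_le_log_of_pos (show 0 < (2 + h) / 4 by positivity)
    rw [Real.log_div (by positivity) (by norm_num), h4, inv_div] at h5
    have h6 : h * (1 / (2 + h) / Real.log 2) = (1 - 2 / (2 + h)) / Real.log 2 := by
      field_simp; ring
    rw [h6, logb, mul_div_assoc', mul_div_assoc']
    apply div_le_div_of_nonneg_right _ hl2.le
    have h7 : 4 / (2 + h) = 2 * (2 / (2 + h)) := by ring
    have h8 : 0 ≤ 2 / (2 + h) := by positivity
    rw [h7] at h5
    linarith
  set l := logb 2 (2 + h)
  calc 1 / (8 * (logb 2 (2 + y)) ^ 2) ≤ 1 / (8 * l ^ 2) := by gcongr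
    _ = (l * (l / 8)) / (l ^ 2) ^ 2 := by field_simp
    _ ≤ _ := by
      gcongr
      nlinarith

theorem le_damped_sub {x y : ℝ} (hx : 0 ≤ x) (hxy : x ≤ y) :
    (y - x) / (8 * (logb 2 (2 + y)) ^ 2) ≤ damped y - damped x := by
  have := (convex_Icc x y).mul_sub_le_image_sub_of_le_deriv (f := damped)
    (C := 1 / (8 * (logb 2 (2 + y)) ^ 2))
    (fun z hz => (hasDerivAt_damped (hx.trans hz.1)).continuousAt.continuousWithinAt)
    (fun z hz => (hasDerivAt_damped
      (hx.trans (interior_subset hz).1)).differentiableAt.differentiableWithinAt)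
    (fun z hz => by
      have hz := interior_subset hz
      rw [(hasDerivAt_damped (hx.trans hz.1)).deriv]
      exact le_deriv_damped (hx.trans hz.1) hz.2)
    x ⟨le_rfl, hxy⟩ y ⟨hxy, le_rfl⟩ hxy
  calc _ = 1 / (8 * (logb 2 (2 + y)) ^ 2) * (y - x) := by ring
    _ ≤ _ := this

theorem damped_mono {x y : ℝ} (hx : 0 ≤ x) (hxy : x ≤ y) : damped x ≤ damped y := by
  have h := le_damped_sub hx hxy
  have : 0 ≤ (y - x) / (8 * (logb 2 (2 + y)) ^ 2) :=
    div_nonneg (by linarith) (by positivity)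
  linarith

theorem logb_two_le_self {x : ℝ} (hx : 0 < x) : logb 2 x ≤ x := by
  have h1 : Real.log (x / 2) ≤ x / 2 - 1 := Real.log_le_sub_one_of_pos (by positivity)
  rw [Real.log_div hx.ne' (by norm_num)] at h1
  have := Real.log_two_gt_d9
  have := Real.log_two_lt_d9
  rw [logb, div_le_iff₀ (by linarith)]
  nlinarith

theorem le_logb_one_add {v : ℝ} (h0 : 0 ≤ v) (h1 : v ≤ 1) : v ≤ logb 2 (1 + v) := by
  rw [Real.le_logb_iff_rpow_le (by norm_num) (by linarith)]
  have := rpow_one_add_le_one_add_mul_self (s := 1) (by norm_num) h0 h1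
  norm_num at this
  linarith

/-- Split at `2 + h = 2^(i/2)`. Above it the denominator is at least `(i/2)²`; below it `h <
2^(i/2)` and `i² ≤ 16 · 2^(i/2)`. -/
theorem damped_le_of_pos {h : ℝ} (hh : 0 ≤ h) {i : ℕ} (hi : 1 ≤ i) :
    damped h ≤ 16 * (2 ^ i + h) / (i : ℝ) ^ 2 := by
  have hi0 : (0 : ℝ) < i := by exact_mod_cast hi
  have h2i : (0 : ℝ) < 2 ^ i := by positivity
  by_cases hc : (2 : ℝ) ^ ((i : ℝ) / 2) ≤ 2 + h
  · have hl : (i : ℝ) / 2 ≤ logb 2 (2 + h) := by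
      rwa [Real.le_logb_iff_rpow_le (by norm_num) (by linarith)]
    calc damped h ≤ h / ((i : ℝ) / 2) ^ 2 := by unfold damped; gcongr
      _ = 4 * h / (i : ℝ) ^ 2 := by field_simp; norm_num
      _ ≤ _ := div_le_div_of_nonneg_right (by linarith) (by positivity)
  · push Not at hc
    have h4 : (i : ℝ) / 4 ≤ 2 ^ ((i : ℝ) / 4) := by
      have := logb_two_le_self (x := (2 : ℝ) ^ ((i : ℝ) / 4)) (by positivity)
      rwa [Real.logb_rpow (by norm_num) (by norm_num)] at this
    have hsq : (2 : ℝ) ^ ((i : ℝ) / 2) = 2 ^ ((i : ℝ) / 4) * 2 ^ ((i : ℝ) / 4) := by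
      rw [← Real.rpow_add (by norm_num)]; ring_nf
    have hi2 : (2 : ℝ) ^ i = 2 ^ ((i : ℝ) / 2) * 2 ^ ((i : ℝ) / 2) := by
      rw [← Real.rpow_add (by norm_num), ← Real.rpow_natCast]; ring_nf
    have h5 : (i : ℝ) ^ 2 ≤ 16 * 2 ^ ((i : ℝ) / 2) := by
      rw [hsq]; nlinarith
    refine (damped_le_self hh).trans ?_
    rw [le_div_iff₀ (by positivity), hi2]
    have h6 : h ≤ 2 ^ ((i : ℝ) / 2) := by linarith
    have := mul_le_mul h6 h5 (by positivity) (by positivity)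
    nlinarith

theorem div_four_le_damped {v h : ℝ} (h0 : 0 ≤ v) (h1 : v ≤ 1) (hh : logb 2 (1 + v) ≤ h) :
    v / 4 ≤ damped h := by
  have hv := le_logb_one_add h0 h1
  refine le_trans ?_ (damped_mono (h0.trans hv) hh)
  have hw : logb 2 (1 + v) ≤ 1 := by
    rw [Real.logb_le_iff_le_rpow (by norm_num) (by linarith)]; norm_num; linarith
  have hl1 := one_le_logb_two_add (h0.trans hv)
  have hl : logb 2 (2 + logb 2 (1 + v)) ≤ 2 := by
    rw [Real.logb_le_iff_le_rpow (by norm_num) (by linarith)]; norm_num; linarith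
  unfold damped
  have hw0 := h0.trans hv
  calc v / 4 = v / 2 ^ 2 := by norm_num
    _ ≤ _ := by gcongr

theorem sq_logb_le_of_large {v : ℝ} (hv : 2 ^ 18 ≤ v) : 16 * (logb 2 (2 + 2 * v)) ^ 2 ≤ v := by
  have hv0 : 0 < v := by linarith
  -- With the fourth root `q` of `v`, the logarithm is at most `5q`, so its square is `O(√v)`; `2^18
  -- > 20^4` gives `q ≥ 20`.
  set q := √(√v) with hq
  have hq0 : 0 < q := by positivity
  have hq4 : q ^ 4 = v := by
    rw [show q ^ 4 = (q ^ 2) ^ 2 by ring, hq, Real.sq_sqrt (by positivity), Real.sq_sqrt hv0.le]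
  have h1 : logb 2 (2 + 2 * v) ≤ 2 + 4 * q := by
    calc logb 2 (2 + 2 * v) ≤ logb 2 (4 * q ^ 4) := logb_two_mono (by linarith) (by linarith)
      _ = 2 + 4 * logb 2 q := by
        rw [Real.logb_mul (by norm_num) (by positivity), Real.logb_pow,
          show (4 : ℝ) = 2 ^ (2 : ℕ) by norm_num, Real.logb_pow, Real.logb_self_eq_one (by norm_num)]
        norm_num
      _ ≤ _ := by linarith [logb_two_le_self hq0]
  have hl := one_le_logb_two_add (h := 2 * v) (by linarith)
  have hq20 : 20 ≤ q := by
    by_contra! hlt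
    have : q ^ 4 < 20 ^ 4 := by gcongr
    norm_num at this
    linarith
  have h2 : logb 2 (2 + 2 * v) ≤ 5 * q := by linarith
  have h3 : (logb 2 (2 + 2 * v)) ^ 2 ≤ (5 * q) ^ 2 := by gcongr
  have h4 : 400 * q ^ 2 ≤ q ^ 2 * q ^ 2 := by
    have : 400 ≤ q ^ 2 := by nlinarith
    gcongr
  nlinarith

/-! ### The potential change of a single link. -/

/-- The increase of the potential when two neighbouring trees with left subtrees of sizes `a` and
`b`, followed by a forest of size `c`, are linked. -/
noncomputable def linkIncrease (a b c : ℝ) : ℝ :=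
  (damped (logb 2 ((a + b + c + 2) / (a + b + 1))) + damped (logb 2 ((a + b + c + 2) / c))
    + damped (logb 2 ((a + b + 1) / a)) + damped (logb 2 ((a + b + 1) / b)))
  - (damped (logb 2 ((a + b + c + 2) / a)) + damped (logb 2 ((a + b + c + 2) / (b + c + 1)))
    + damped (logb 2 ((b + c + 1) / b)) + damped (logb 2 ((b + c + 1) / c)))

theorem logb_div_nonneg {x y : ℝ} (hx : 0 < x) (hxy : x ≤ y) : 0 ≤ logb 2 (y / x) :=
  Real.logb_nonneg (by norm_num) ((one_le_div hx).2 hxy)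

theorem damped_div_mono {x y x' y' : ℝ} (hx : 0 < x) (hx' : 0 < x') (hxy : x ≤ y)
    (h : y * x' ≤ y' * x) : damped (logb 2 (y / x)) ≤ damped (logb 2 (y' / x')) := by
  apply damped_mono (logb_div_nonneg hx hxy)
  apply logb_two_mono (div_pos (hx.trans_le hxy) hx)
  rwa [div_le_div_iff₀ hx hx']

theorem damped_div_sub {x y z : ℝ} (hx : 0 < x) (hxy : x ≤ y) (hyz : y ≤ z) :
    damped (logb 2 (z / x)) ≤ damped (logb 2 (z / y)) + damped (logb 2 (y / x)) := by
  have hy := hx.trans_le hxy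
  have hz := hy.trans_le hyz
  rw [show z / x = (z / y) * (y / x) by field_simp,
    Real.logb_mul (by positivity) (by positivity)]
  exact damped_add_le (logb_div_nonneg hy hyz) (logb_div_nonneg hx hxy)

/-- Subadditivity cancels the terms on the spine (those with `c` or `b + c + 1` below the bar). The
new term of `a + b + 1` is then dominated by the old term of the larger subtree, leaving the old
term of the smaller one, `m`, as a gain. -/
theorem linkIncrease_le {a b c : ℝ} (ha : 1 ≤ a) (hb : 1 ≤ b) (hc : 1 ≤ c) :
    ∃ m M, 1 ≤ m ∧ m ≤ M ∧ m + M = a + b ∧ (m = a ∨ m = b) ∧ m ≤ b ∧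
      linkIncrease a b c ≤ damped (logb 2 ((a + b + 1) / M)) + damped (logb 2 ((a + b + 1) / m))
        - damped (logb 2 ((b + c + 1) / m)) := by
  have h1 : damped (logb 2 ((a + b + c + 2) / c)) ≤ damped (logb 2 ((a + b + c + 2) / (b + c + 1)))
      + damped (logb 2 ((b + c + 1) / c)) :=
    damped_div_sub (by linarith) (by linarith) (by linarith)
  rcases le_total b a with h | h
  · refine ⟨b, a, hb, h, by ring, Or.inr rfl, le_rfl, ?_⟩
    have h2 : damped (logb 2 ((a + b + c + 2) / (a + b + 1)))
        ≤ damped (logb 2 ((a + b + c + 2) / a)) :=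
      damped_div_mono (by linarith) (by linarith) (by linarith) (by nlinarith)
    unfold linkIncrease
    linarith
  · refine ⟨a, b, ha, h, by ring, Or.inl rfl, h, ?_⟩
    have h2 : damped (logb 2 ((a + b + c + 2) / (a + b + 1)))
        ≤ damped (logb 2 ((b + c + 1) / b)) :=
      damped_div_mono (by linarith) (by linarith) (by linarith) (by nlinarith)
    have h3 : damped (logb 2 ((b + c + 1) / a)) ≤ damped (logb 2 ((a + b + c + 2) / a)) :=
      damped_div_mono (by linarith) (by linarith) (by linarith) (by nlinarith)
    unfold linkIncrease
    linarith

theorem damped_div_le_of_add {m M u : ℝ} (hm : 1 ≤ m) (hM : m ≤ M) (hu : u = m + M + 1) :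
    damped (logb 2 (u / M)) ≤ 2 ∧ damped (logb 2 (u / M)) ≤ 12 * (m / u) := by
  have hM0 : 0 < M := by linarith
  have h0 : 0 ≤ logb 2 (u / M) := logb_div_nonneg hM0 (by linarith)
  refine ⟨(damped_le_self h0).trans ?_, (damped_le_self h0).trans ?_⟩
  · rw [Real.logb_le_iff_le_rpow (by norm_num) (div_pos (by linarith) hM0), div_le_iff₀ hM0]
    norm_num
    linarith
  · have h1 : Real.log (u / M) ≤ u / M - 1 :=
      Real.log_le_sub_one_of_pos (div_pos (by linarith) hM0)
    have h2 := Real.log_two_gt_d9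
    have h3 : u / M - 1 ≤ 2 * m / M := by
      rw [div_sub_one hM0.ne']; gcongr; linarith
    have h4 : 2 * m / M ≤ 6 * (m / u) := by
      rw [mul_div_assoc', div_le_div_iff₀ hM0 (by linarith)]; nlinarith
    have h5 : 0 ≤ m / u := div_nonneg (by linarith) (by linarith)
    rw [logb, div_le_iff₀ (by linarith)]
    nlinarith

theorem logb_div_eq_sub {x y : ℝ} (hx : 0 < x) (hy : 0 < y) :
    logb 2 (x / y) = logb 2 x - logb 2 y := Real.logb_div hx.ne' hy.ne'

/-- The constant in the bound for the loss of potential in a pairing round. -/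
noncomputable def lossConst : ℝ := 48 * 2 ^ ((2 : ℝ) ^ 18)

theorem le_lossConst : 48 ≤ lossConst := by
  have : (1 : ℝ) ≤ 2 ^ ((2 : ℝ) ^ 18) := Real.one_le_rpow (by norm_num) (by positivity)
  unfold lossConst
  linarith

theorem linkIncrease_le_lossConst {a b c : ℝ} (ha : 1 ≤ a) (hb : 1 ≤ b) (hc : 1 ≤ c) :
    linkIncrease a b c ≤ lossConst * damped (logb 2 ((a + b + c + 2) / c)) := by
  obtain ⟨m, M, hm, hmM, hsum, -, hmb, hle⟩ := linkIncrease_le ha hb hc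
  obtain ⟨hA, hB⟩ := damped_div_le_of_add hm hmM (u := a + b + 1) (by linarith)
  refine hle.trans ?_
  have hC := le_lossConst
  have hH : 0 ≤ logb 2 ((a + b + c + 2) / c) := logb_div_nonneg (by linarith) (by linarith)
  have hg := damped_nonneg hH
  -- If `t = b + c + 1 ≤ u = a + b + 1`, then `s ≥ 2c`, so the target is at least a constant and
  -- absorbs the bounded term of `M`.
  rcases le_total (b + c + 1) (a + b + 1) with htu | htu
  · have h1 : damped (logb 2 ((a + b + 1) / m)) ≤ damped (logb 2 ((a + b + 1) / (b + c + 1)))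
        + damped (logb 2 ((b + c + 1) / m)) :=
      damped_div_sub (by linarith) (by linarith) htu
    have h2 : damped (logb 2 ((a + b + 1) / (b + c + 1)))
        ≤ damped (logb 2 ((a + b + c + 2) / c)) :=
      damped_div_mono (by linarith) (by linarith) htu (by nlinarith)
    have h3 : 1 / 4 ≤ damped (logb 2 ((a + b + c + 2) / c)) := by
      refine div_four_le_damped (by norm_num) le_rfl (logb_two_mono (by norm_num) ?_)
      rw [le_div_iff₀ (by linarith)]; linarith
    nlinarith
  · have hX : 0 ≤ logb 2 ((a + b + 1) / m) := logb_div_nonneg (by linarith) (by linarith)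
    have hXY : logb 2 ((a + b + 1) / m) ≤ logb 2 ((b + c + 1) / m) :=
      logb_two_mono (div_pos (by linarith) (by linarith)) (by gcongr)
    have hV : logb 2 ((b + c + 1) / m) - logb 2 ((a + b + 1) / m)
        = logb 2 ((b + c + 1) / (a + b + 1)) := by
      rw [logb_div_eq_sub, logb_div_eq_sub, logb_div_eq_sub] <;> linarith
    set u := a + b + 1 with hudef
    set t := b + c + 1
    set X := logb 2 (u / m)
    set Y := logb 2 (t / m)
    have hu : 0 < u := by linarith
    have ht : 0 < t := by linarith
    -- Here `Y - X = log (t / u)`. If it is huge and at least `X`, the gain `damped Y - damped X` is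
    -- at least `2` and covers the term of `M`. Otherwise `t / u` is bounded or at most `u / m`;
    -- either way the term of `M` is `O(u / t)`, which the target dominates because `s / c ≥ 1 + u /
    -- t`.
    by_cases hbig : 2 ^ 18 ≤ Y - X ∧ X ≤ Y - X
    · have h1 := le_damped_sub hX hXY
      have h2 := sq_logb_le_of_large hbig.1
      have h3 : logb 2 (2 + Y) ≤ logb 2 (2 + 2 * (Y - X)) :=
        logb_two_mono (by linarith) (by linarith)
      have h4 := one_le_logb_two_add (hX.trans hXY)
      have h5 : 2 ≤ (Y - X) / (8 * (logb 2 (2 + Y)) ^ 2) := by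
        rw [le_div_iff₀ (by positivity)]
        have : logb 2 (2 + Y) ^ 2 ≤ logb 2 (2 + 2 * (Y - X)) ^ 2 := by gcongr
        linarith
      have := mul_nonneg (by linarith : 0 ≤ lossConst) hg
      linarith
    · have h1 := damped_mono hX hXY
      have h2 : damped (logb 2 (u / M)) ≤ 12 * 2 ^ ((2 : ℝ) ^ 18) * (u / t) := by
        have hp : (1 : ℝ) ≤ 2 ^ ((2 : ℝ) ^ 18) := Real.one_le_rpow (by norm_num) (by positivity)
        rcases not_and_or.1 hbig with h | h
        · push Not at h
          have h3 : t / u ≤ 2 ^ ((2 : ℝ) ^ 18) := by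
            rw [hV] at h
            exact ((Real.logb_lt_iff_lt_rpow (by norm_num) (by positivity)).1 h).le
          have h4 : 1 ≤ 2 ^ ((2 : ℝ) ^ 18) * (u / t) := by
            calc (1 : ℝ) = (t / u) * (u / t) := by field_simp
              _ ≤ _ := by gcongr
          nlinarith
        · push Not at h
          have h3 : t / u ≤ u / m := by
            rw [hV] at h
            exact ((Real.logb_lt_logb_iff (by norm_num) (by positivity)
              (div_pos hu (by linarith))).1 h).le
          have h4 : m / u ≤ u / t := by
            have := inv_anti₀ (by positivity) h3
            simpa only [inv_div] using this
          have h5 : 0 ≤ u / t := by positivity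
          calc damped (logb 2 (u / M)) ≤ 12 * (m / u) := hB
            _ ≤ 12 * 1 * (u / t) := by linarith
            _ ≤ _ := by gcongr
      have h3 : u / t / 4 ≤ damped (logb 2 ((a + b + c + 2) / c)) := by
        refine div_four_le_damped (by positivity) ((div_le_one ht).2 htu)
          (logb_two_mono (by positivity) ?_)
        calc 1 + u / t ≤ 1 + u / c := by gcongr; linarith
          _ ≤ _ := by
            rw [one_add_div (by linarith)]
            exact div_le_div_of_nonneg_right (by linarith) (by linarith)
      have h4 : lossConst * (u / t / 4) ≤ lossConst * damped (logb 2 ((a + b + c + 2) / c)) := by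
        gcongr
      have h5 : lossConst * (u / t / 4) = 12 * 2 ^ ((2 : ℝ) ^ 18) * (u / t) := by
        unfold lossConst; ring
      linarith

/-- If neighbouring trees of logarithmic height at most `h` are linked without a constant gain of
potential, then the resulting tree has logarithmic height at most `shrink h`. -/
noncomputable def shrink (h : ℝ) : ℝ := 2 + 24 * (logb 2 (2 + h)) ^ 2

theorem linkIncrease_le_neg_one {a b c h : ℝ} (ha : 1 ≤ a) (hb : 1 ≤ b) (hc : 1 ≤ c)
    (hs : logb 2 ((a + b + c + 2) / a) ≤ h) (ht : logb 2 ((b + c + 1) / b) ≤ h)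
    (hu : shrink h < logb 2 ((a + b + c + 2) / (a + b + 1))) :
    linkIncrease a b c ≤ -1 := by
  obtain ⟨m, M, hm, hmM, hsum, hmab, hmb, hle⟩ := linkIncrease_le ha hb hc
  obtain ⟨hA, -⟩ := damped_div_le_of_add hm hmM (u := a + b + 1) (by linarith)
  have hsq : 0 ≤ logb 2 (2 + h) ^ 2 := by positivity
  have hs2 : 2 ≤ shrink h := by unfold shrink; linarith
  have h4 : 4 < (a + b + c + 2) / (a + b + 1) := by
    have := (Real.lt_logb_iff_rpow_lt (b := 2) (by norm_num)
      (by apply div_pos <;> linarith)).1 (hs2.trans_lt hu)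
    norm_num at this
    exact this
  rw [lt_div_iff₀ (by linarith)] at h4
  have hX : 0 ≤ logb 2 ((a + b + 1) / m) := logb_div_nonneg (by linarith) (by linarith)
  have hXY : logb 2 ((a + b + 1) / m) ≤ logb 2 ((b + c + 1) / m) :=
    logb_two_mono (div_pos (by linarith) (by linarith))
      (div_le_div_of_nonneg_right (by linarith) (by linarith))
  have hYh : logb 2 ((b + c + 1) / m) ≤ h := by
    rcases hmab with rfl | rfl
    · refine (logb_two_mono (div_pos (by linarith) (by linarith)) ?_).trans hs
      exact div_le_div_of_nonneg_right (by linarith) (by linarith)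
    · exact ht
  have hV : logb 2 ((b + c + 1) / m) - logb 2 ((a + b + 1) / m)
      = logb 2 ((b + c + 1) / (a + b + 1)) := by
    rw [logb_div_eq_sub, logb_div_eq_sub, logb_div_eq_sub] <;> linarith
  -- Since `a + b + 1` is less than a quarter of the whole, `b + c + 1` is more than half of it.
  have hsV : logb 2 ((a + b + c + 2) / (a + b + 1)) ≤ 1 + logb 2 ((b + c + 1) / (a + b + 1)) := by
    have h2 : 1 + logb 2 ((b + c + 1) / (a + b + 1))
        = logb 2 (2 * ((b + c + 1) / (a + b + 1))) := by
      rw [Real.logb_mul (by norm_num) (div_pos (by linarith) (by linarith)).ne',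
        Real.logb_self_eq_one (by norm_num)]
    rw [h2, mul_div_assoc']
    exact logb_two_mono (div_pos (by linarith) (by linarith))
      (div_le_div_of_nonneg_right (by linarith) (by linarith))
  have h1 := le_damped_sub hX hXY
  have h2 := one_le_logb_two_add (hX.trans hXY)
  have h3 : logb 2 (2 + logb 2 ((b + c + 1) / m)) ≤ logb 2 (2 + h) :=
    logb_two_mono (by linarith) (by linarith)
  -- The coefficient `24 = 3 · 8` in `shrink` makes the gain `3`, against a loss of at most `2` from
  -- the term of `M`.
  have h5 : 3 ≤ (logb 2 ((b + c + 1) / m) - logb 2 ((a + b + 1) / m)) /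
      (8 * (logb 2 (2 + logb 2 ((b + c + 1) / m))) ^ 2) := by
    rw [le_div_iff₀ (by positivity), hV]
    have : logb 2 (2 + logb 2 ((b + c + 1) / m)) ^ 2 ≤ logb 2 (2 + h) ^ 2 := by gcongr
    unfold shrink at hu
    linarith
  linarith

/-- Thresholds of the form `1024 (3 + w)²` are kept by `shrink`, with `w` replaced by `log w`; so
iterating `shrink` is governed by the iterated logarithm. -/
theorem shrink_le {w : ℝ} (hw : 1 ≤ w) :
    shrink (1024 * (3 + w) ^ 2) ≤ 1024 * (3 + logb 2 w) ^ 2 := by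
  have hv : 0 ≤ logb 2 w := Real.logb_nonneg (by norm_num) hw
  have h1 : logb 2 (2 + 1024 * (3 + w) ^ 2) ≤ 15 + 2 * logb 2 w := by
    calc logb 2 (2 + 1024 * (3 + w) ^ 2) ≤ logb 2 (2 ^ 15 * w ^ 2) :=
          logb_two_mono (by positivity) (by nlinarith)
      _ = _ := by
        rw [Real.logb_mul (by norm_num) (by positivity), Real.logb_pow, Real.logb_pow,
          Real.logb_self_eq_one (by norm_num)]
        norm_num
  have h2 := one_le_logb_two_add (h := 1024 * (3 + w) ^ 2) (by positivity)
  have h3 : logb 2 (2 + 1024 * (3 + w) ^ 2) ^ 2 ≤ (15 + 2 * logb 2 w) ^ 2 := by gcongr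
  unfold shrink
  nlinarith

-- Sizes, high roots and losses along the spine of a forest.

universe u

variable {α : Type u}

theorem one_le_extSize (F : BinaryTree α) : 1 ≤ extSize F := by
  cases F <;> simp [extSize]

theorem one_le_extSize_cast (F : BinaryTree α) : (1 : ℝ) ≤ extSize F := by
  exact_mod_cast one_le_extSize F

theorem extSize_eq (F : BinaryTree α) : extSize F = 2 * F.numNodes + 1 := by
  induction F with
  | nil => rfl
  | node x L R hL hR => simp only [extSize, BinaryTree.numNodes, hL, hR]; omega

theorem nodePotential_nonneg {s t : ℕ} (ht : 1 ≤ t) (hts : t ≤ s) : 0 ≤ nodePotential s t :=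
  damped_nonneg (logb_div_nonneg (by exact_mod_cast ht) (by exact_mod_cast hts))

theorem potential_nonneg (F : BinaryTree α) : 0 ≤ potential F := by
  induction F with
  | nil => exact le_rfl
  | node x L R hL hR =>
    have h1 := nodePotential_nonneg (s := extSize (.node x L R)) (one_le_extSize L)
      (by simp only [extSize]; omega)
    have h2 := nodePotential_nonneg (s := extSize (.node x L R)) (one_le_extSize R)
      (by simp only [extSize]; omega)
    simp only [potential]
    linarith

/-- The logarithm of the size of a forest. -/
noncomputable def logSize (F : BinaryTree α) : ℝ := logb 2 (extSize F)

theorem logSize_nonneg (F : BinaryTree α) : 0 ≤ logSize F :=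
  Real.logb_nonneg (by norm_num) (one_le_extSize_cast F)

/-- The number of top-level nodes whose left subtree has logarithmic height more than `h`. -/
noncomputable def highRoots (h : ℝ) : BinaryTree α → ℝ
  | .nil => 0
  | .node x A C =>
      (if logb 2 ((extSize (.node x A C) : ℝ) / extSize A) ≤ h then 0 else 1) + highRoots h C

/-- The sum over the links of a pairing round of the potential that bounds their loss. -/
noncomputable def spineLoss : BinaryTree α → ℝ
  | .node x A (.node y B C) =>
      damped (logb 2 ((extSize (.node x A (.node y B C)) : ℝ) / extSize C)) + spineLoss C
  | .node _ _ .nil => 0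
  | .nil => 0

theorem numRoots_nil : numRoots (.nil : BinaryTree α) = 0 := rfl

theorem numRoots_node (x : α) (A C : BinaryTree α) :
    numRoots (.node x A C) = numRoots C + 1 := rfl

theorem extSize_node_cast (x : α) (A C : BinaryTree α) :
    (extSize (.node x A C) : ℝ) = extSize A + extSize C + 1 := by
  simp only [extSize]; push_cast; ring

theorem potential_node (x : α) (A C : BinaryTree α) :
    potential (.node x A C) =
      damped (logb 2 (((extSize A : ℝ) + extSize C + 1) / extSize A))
        + damped (logb 2 (((extSize A : ℝ) + extSize C + 1) / extSize C))
        + potential A + potential C := by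
  simp only [potential, nodePotential_eq, extSize_node_cast]

theorem logSize_mono_node (x : α) (A C : BinaryTree α) : logSize C ≤ logSize (.node x A C) := by
  have := one_le_extSize_cast A
  have := one_le_extSize_cast C
  apply logb_two_mono (by linarith)
  rw [extSize_node_cast]
  linarith

/-- The arguments of `damped` are differences of log-sizes along the spine, so the linear part
telescopes; `p` is paid once per link. -/
theorem spineLoss_le_mul_add {p q : ℝ} (hp : 0 ≤ p) (hq : 0 ≤ q)
    (hpq : ∀ h, 0 ≤ h → damped h ≤ p + q * h) (F : BinaryTree α) :
    spineLoss F ≤ p * (numRoots F - 1 : ℕ) + q * logSize F := by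
  induction F using spineLoss.induct with
  | case1 x A y B C ih =>
    have hC := one_le_extSize_cast C
    have hs : (extSize C : ℝ) ≤ extSize (.node x A (.node y B C)) := by
      simp only [extSize_node_cast]
      linarith [one_le_extSize_cast A, one_le_extSize_cast B]
    have h1 := hpq _ (logb_div_nonneg (by linarith) hs)
    rw [logb_div_eq_sub (by linarith) (by linarith)] at h1
    have h2 : ((numRoots C - 1 : ℕ) : ℝ) + 1
        ≤ ((numRoots (.node x A (.node y B C)) - 1 : ℕ) : ℝ) := by
      simp only [numRoots_node]
      exact_mod_cast (by omega)
    have h3 := mul_le_mul_of_nonneg_left h2 hp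
    rw [spineLoss, logb_div_eq_sub (by linarith) (by linarith)]
    simp only [logSize] at ih h1 ⊢
    linarith
  | case2 x A =>
    have := logSize_nonneg (.node x A .nil)
    simp only [spineLoss]
    positivity
  | case3 =>
    have := logSize_nonneg (.nil : BinaryTree α)
    simp only [spineLoss]
    positivity

theorem spineLoss_le_logSize (F : BinaryTree α) : spineLoss F ≤ logSize F := by
  simpa using spineLoss_le_mul_add le_rfl zero_le_one
    (fun h hh => by simpa using damped_le_self hh) F

theorem spineLoss_le_div_sq (F : BinaryTree α) {i : ℕ} (hi : 1 ≤ i) :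
    spineLoss F ≤ 16 * (2 ^ i * (numRoots F - 1 : ℕ) + logSize F) / (i : ℝ) ^ 2 := by
  refine (spineLoss_le_mul_add (p := 16 * 2 ^ i / (i : ℝ) ^ 2) (q := 16 / (i : ℝ) ^ 2)
    (by positivity) (by positivity) (fun h hh => ?_) F).trans_eq (by ring)
  exact (damped_le_of_pos hh hi).trans_eq (by ring)

theorem highRoots_nonneg (h : ℝ) (F : BinaryTree α) : 0 ≤ highRoots h F := by
  induction F with
  | nil => exact le_rfl
  | node x A C _ ih =>
    rw [highRoots]
    split_ifs <;> linarith

theorem highRoots_eq_zero {h : ℝ} (F : BinaryTree α) (hF : logSize F ≤ h) :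
    highRoots h F = 0 := by
  induction F with
  | nil => rfl
  | node x A C _ ih =>
    have hA := one_le_extSize_cast A
    have h1 : logb 2 ((extSize (.node x A C) : ℝ) / extSize A) ≤ h := by
      rw [logb_div_eq_sub (by linarith [one_le_extSize_cast (.node x A C)]) (by linarith)]
      have := logSize_nonneg A
      unfold logSize at this hF
      linarith
    rw [highRoots, if_pos h1, ih ((logSize_mono_node x A C).trans hF), add_zero]

/-- The left subtree of a low root holds at least a `2^(-H)` fraction of the size, so passing that
root lowers the log-size of the remaining forest by at least `2^(-H)`. -/
theorem numRoots_le_highRoots_add {h H : ℝ} (hH : 0 ≤ H) (hhH : h ≤ H) (F : BinaryTree α) :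
    (numRoots F : ℝ) ≤ highRoots h F + 2 ^ H * logSize F := by
  have hp : (1 : ℝ) ≤ 2 ^ H := Real.one_le_rpow (by norm_num) hH
  induction F with
  | nil => simp [numRoots_nil, highRoots, logSize, extSize]
  | node x A C _ ih =>
    have hA := one_le_extSize_cast A
    have hC := one_le_extSize_cast C
    have hmono := logSize_mono_node x A C
    rw [numRoots_node, highRoots]
    push_cast
    split_ifs with hl
    · have hs : (extSize (.node x A C) : ℝ) ≤ 2 ^ H * extSize A := by
        have := (Real.logb_le_iff_le_rpow (by norm_num)
          (div_pos (by linarith [one_le_extSize_cast (.node x A C)]) (by linarith))).1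
          (hl.trans hhH)
        rwa [div_le_iff₀ (by linarith)] at this
      have h1 : 1 / 2 ^ H ≤ logSize (.node x A C) - logSize C := by
        refine (le_logb_one_add (by positivity) ((div_le_one (by linarith)).2 hp)).trans ?_
        unfold logSize
        rw [← logb_div_eq_sub (by linarith [one_le_extSize_cast (.node x A C)]) (by linarith)]
        apply logb_two_mono (by positivity)
        rw [one_add_div (by positivity), div_le_div_iff₀ (by positivity) (by linarith)]
        rw [extSize_node_cast] at hs ⊢
        nlinarith
      rw [div_le_iff₀ (by positivity)] at h1
      linarith
    · have := mul_le_mul_of_nonneg_left hmono (by linarith : (0 : ℝ) ≤ 2 ^ H)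
      linarith

theorem potential_link (x y x' y' : α) (A B C D : BinaryTree α) (hD : extSize D = extSize C) :
    potential (.node x' (.node y' A B) D) + potential C =
      potential (.node x A (.node y B C)) + linkIncrease (extSize A) (extSize B) (extSize C)
        + potential D := by
  simp only [potential_node, extSize_node_cast, linkIncrease, hD]
  rw [show (extSize A : ℝ) + extSize B + 1 + extSize C + 1
      = extSize A + extSize B + extSize C + 2 by ring,
    show (extSize A : ℝ) + (extSize B + extSize C + 1) + 1
      = extSize A + extSize B + extSize C + 2 by ring]
  ring

theorem two_le_shrink (h : ℝ) : 2 ≤ shrink h := by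
  unfold shrink
  linarith [sq_nonneg (logb 2 (2 + h))]

/-- A new high root is paid for by an old high root if there is one, and by the unit drop of
`linkIncrease_le_neg_one` if not. -/
theorem linkIncrease_add_high_le (h : ℝ) {a b c : ℝ} (ha : 1 ≤ a) (hb : 1 ≤ b) (hc : 1 ≤ c) :
    linkIncrease a b c
        + (if logb 2 ((a + b + c + 2) / (a + b + 1)) ≤ shrink h then 0 else 1 : ℝ)
      ≤ lossConst * damped (logb 2 ((a + b + c + 2) / c))
        + (if logb 2 ((a + b + c + 2) / a) ≤ h then 0 else 1 : ℝ)
        + (if logb 2 ((b + c + 1) / b) ≤ h then 0 else 1 : ℝ) := by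
  have h1 := linkIncrease_le_lossConst ha hb hc
  have h2 : 0 ≤ lossConst * damped (logb 2 ((a + b + c + 2) / c)) :=
    mul_nonneg (by linarith [le_lossConst])
      (damped_nonneg (logb_div_nonneg (by linarith) (by linarith)))
  by_cases hu : logb 2 ((a + b + c + 2) / (a + b + 1)) ≤ shrink h
  · rw [if_pos hu]
    split_ifs <;> linarith
  by_cases hs : logb 2 ((a + b + c + 2) / a) ≤ h
  · by_cases ht : logb 2 ((b + c + 1) / b) ≤ h
    · have := linkIncrease_le_neg_one ha hb hc hs ht (not_le.1 hu)
      rw [if_neg hu, if_pos hs, if_pos ht]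
      linarith
    · rw [if_neg hu, if_pos hs, if_neg ht]
      linarith
  · rw [if_neg hu, if_neg hs]
    split_ifs <;> linarith

/-! ### Pairing rounds and their repetition. -/

section Round

variable [LinearOrder α]

theorem extSize_pairingRound (F : BinaryTree α) : extSize (pairingRound F) = extSize F := by
  induction F using pairingRound.induct with
  | case1 x A y B C h ih =>
    simp only [pairingRound, if_pos h, extSize, ih]; omega
  | case2 x A y B C h ih =>
    simp only [pairingRound, if_neg h, extSize, ih]; omega
  | case3 x A => rfl
  | case4 => rfl

theorem logSize_pairingRound (F : BinaryTree α) : logSize (pairingRound F) = logSize F := by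
  rw [logSize, extSize_pairingRound, logSize]

/-- The outcome of the comparison only swaps `A` and `B` below the loser, and the potential is
symmetric in them. -/
theorem pairingRound_node_node (x y : α) (A B C : BinaryTree α) :
    ∃ x' y' A' B',
      pairingRound (.node x A (.node y B C)) = .node x' (.node y' A' B') (pairingRound C) ∧
      extSize A' + extSize B' = extSize A + extSize B ∧
      ∀ D, potential (.node x' (.node y' A' B') D) = potential (.node x' (.node y' A B) D) := by
  by_cases h : x ≤ y
  · refine ⟨x, y, B, A, by simp [pairingRound, h], add_comm _ _, fun D => ?_⟩
    simp only [potential_node, extSize_node_cast, add_comm (extSize B : ℝ)]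
    ring
  · exact ⟨y, x, A, B, by simp [pairingRound, h], rfl, fun D => rfl⟩

theorem potential_pairingRound_add_highRoots_le (h : ℝ) (F : BinaryTree α) :
    potential (pairingRound F) + highRoots (shrink h) (pairingRound F)
      ≤ potential F + highRoots h F + lossConst * spineLoss F := by
  have main : ∀ (x y : α) (A B C : BinaryTree α),
      potential (pairingRound C) + highRoots (shrink h) (pairingRound C)
        ≤ potential C + highRoots h C + lossConst * spineLoss C →
      potential (pairingRound (.node x A (.node y B C)))
          + highRoots (shrink h) (pairingRound (.node x A (.node y B C)))
        ≤ potential (.node x A (.node y B C)) + highRoots h (.node x A (.node y B C))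
          + lossConst * spineLoss (.node x A (.node y B C)) := by
    intro x y A B C ih
    have hC := extSize_pairingRound C
    obtain ⟨x', y', A', B', hr, hAB, hp⟩ := pairingRound_node_node x y A B C
    have hl := potential_link x y x' y' A B C _ hC
    have hAB' : (extSize A' : ℝ) + extSize B' = extSize A + extSize B := by exact_mod_cast hAB
    have hk := linkIncrease_add_high_le h (one_le_extSize_cast A) (one_le_extSize_cast B)
      (one_le_extSize_cast C)
    rw [hr, hp, highRoots, highRoots, highRoots, spineLoss]
    simp only [extSize_node_cast, hC, hAB']
    rw [show (extSize A : ℝ) + extSize B + 1 + extSize C + 1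
        = extSize A + extSize B + extSize C + 2 by ring,
      show (extSize A : ℝ) + (extSize B + extSize C + 1) + 1
        = extSize A + extSize B + extSize C + 2 by ring]
    linarith
  induction F using pairingRound.induct with
  | case1 x A y B C _ ih => exact main x y A B C ih
  | case2 x A y B C _ ih => exact main x y A B C ih
  | case3 x A =>
    have hA := one_le_extSize_cast A
    -- An unpaired last tree has only an external node to its right, so it is low for every
    -- threshold that is at least `2`.
    have h1 : logb 2 ((extSize (.node x A .nil) : ℝ) / extSize A) ≤ shrink h := by
      refine le_trans ?_ (two_le_shrink h)
      rw [Real.logb_le_iff_le_rpow (by norm_num)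
        (div_pos (by linarith [one_le_extSize_cast (.node x A .nil)]) (by linarith)),
        div_le_iff₀ (by linarith), extSize_node_cast]
      norm_num [extSize]
      linarith
    have h2 := highRoots_nonneg h (.node x A .nil)
    have h3 : highRoots (shrink h) (.node x A .nil) = 0 := by
      rw [highRoots, if_pos h1, highRoots, add_zero]
    simp only [pairingRound, h3, spineLoss]
    linarith
  | case4 => simp [pairingRound, highRoots, spineLoss]

theorem potential_pairingRound_le (F : BinaryTree α) :
    potential (pairingRound F) ≤ potential F + lossConst * spineLoss F := by
  have h1 := potential_pairingRound_add_highRoots_le (logSize F) F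
  have h2 := highRoots_nonneg (shrink (logSize F)) (pairingRound F)
  rw [highRoots_eq_zero F le_rfl] at h1
  linarith

theorem pairingRound_eq_self {F : BinaryTree α} (hF : numRoots F ≤ 1) : pairingRound F = F := by
  match F with
  | .nil => rfl
  | .node x A .nil => rfl
  | .node x A (.node y B C) => simp [numRoots_node] at hF

theorem multipass_pairingRound (F : BinaryTree α) : multipass (pairingRound F) = multipass F := by
  by_cases h : numRoots F ≤ 1
  · rw [pairingRound_eq_self h]
  · conv_rhs => rw [multipass, if_neg h]

theorem multipass_iterate (r : ℕ) (F : BinaryTree α) :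
    multipass (pairingRound^[r] F) = multipass F := by
  induction r with
  | zero => rfl
  | succ r ih => rw [Function.iterate_succ_apply', multipass_pairingRound, ih]

theorem multipass_eq_self {F : BinaryTree α} (hF : numRoots F ≤ 1) : multipass F = F := by
  rw [multipass, if_pos hF]

theorem numRoots_multipass_le (F : BinaryTree α) : numRoots (multipass F) ≤ 1 := by
  induction F using multipass.induct with
  | case1 F h => rwa [multipass_eq_self h]
  | case2 F h ih => rwa [multipass_pairingRound] at ih

theorem extSize_multipass (F : BinaryTree α) : extSize (multipass F) = extSize F := by
  induction F using multipass.induct with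
  | case1 F h => rw [multipass_eq_self h]
  | case2 F h ih => rwa [multipass_pairingRound, extSize_pairingRound] at ih

theorem logSize_iterate (r : ℕ) (F : BinaryTree α) :
    logSize (pairingRound^[r] F) = logSize F := by
  induction r with
  | zero => rfl
  | succ r ih => rw [Function.iterate_succ_apply', logSize_pairingRound, ih]

theorem numRoots_le_iterate (r : ℕ) (F : BinaryTree α) :
    numRoots F ≤ 2 ^ r * numRoots (pairingRound^[r] F) := by
  induction r with
  | zero => simp
  | succ r ih =>
    rw [Function.iterate_succ_apply', numRoots_pairingRound, pow_succ, mul_assoc]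
    refine ih.trans (Nat.mul_le_mul_left _ (by omega))

theorem numRoots_iterate_le (r : ℕ) (F : BinaryTree α) :
    numRoots (pairingRound^[r] F) ≤ numRoots F := by
  induction r with
  | zero => simp
  | succ r ih =>
    rw [Function.iterate_succ_apply', numRoots_pairingRound]
    omega

theorem potential_iterate_add_highRoots_le (h : ℝ) (r : ℕ) (F : BinaryTree α) :
    potential (pairingRound^[r] F) + highRoots (shrink^[r] h) (pairingRound^[r] F)
      ≤ potential F + highRoots h F + r * lossConst * logSize F := by
  induction r with
  | zero => simp
  | succ r ih =>
    rw [Function.iterate_succ_apply', Function.iterate_succ_apply']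
    have h1 := potential_pairingRound_add_highRoots_le (shrink^[r] h) (pairingRound^[r] F)
    have h2 := spineLoss_le_logSize (pairingRound^[r] F)
    rw [logSize_iterate] at h2
    have h3 := mul_le_mul_of_nonneg_left h2 (by linarith [le_lossConst] : 0 ≤ lossConst)
    push_cast
    linarith

theorem potential_iterate_add_numRoots_le {h H : ℝ} {r : ℕ} {F : BinaryTree α} (hH : 0 ≤ H)
    (hF : logSize F ≤ h) (hr : shrink^[r] h ≤ H) :
    potential (pairingRound^[r] F) + numRoots F / 2 ^ r
      ≤ potential F + (r * lossConst + 2 ^ H) * logSize F := by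
  have h1 := potential_iterate_add_highRoots_le h r F
  have h2 := numRoots_le_highRoots_add hH hr (pairingRound^[r] F)
  rw [logSize_iterate] at h2
  rw [highRoots_eq_zero F hF] at h1
  have h3 : (numRoots F : ℝ) / 2 ^ r ≤ numRoots (pairingRound^[r] F) := by
    rw [div_le_iff₀' (by positivity)]
    exact_mod_cast numRoots_le_iterate r F
  linarith

/-- If the forest has few trees compared with the logarithm of its size, then the losses of the
pairing rounds are summable. -/
theorem potential_multipass_le_of_few (F : BinaryTree α) (i : ℕ) (hi : 1 ≤ i)
    (hF : (2 : ℝ) ^ i * (numRoots F - 1 : ℕ) ≤ logSize F) :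
    potential (multipass F) ≤ potential F + 64 * lossConst * logSize F / i := by
  have hl := le_lossConst
  induction F using multipass.induct generalizing i with
  | case1 F h =>
    have := logSize_nonneg F
    rw [multipass_eq_self h]
    have : 0 ≤ 64 * lossConst * logSize F / i := by positivity
    linarith
  | case2 F h ih =>
    have hn := logSize_nonneg F
    have hi0 : (1 : ℝ) ≤ i := by exact_mod_cast hi
    -- Counting `numRoots F - 1` is what makes a round halve the quantity despite rounding up.
    have h1 := ih (i + 1) (by omega) (by
      rw [logSize_pairingRound, numRoots_pairingRound]
      refine le_trans ?_ hF
      have : (2 : ℝ) * ((numRoots F + 1) / 2 - 1 : ℕ) ≤ (numRoots F - 1 : ℕ) := by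
        exact_mod_cast (by omega : 2 * ((numRoots F + 1) / 2 - 1) ≤ numRoots F - 1)
      rw [pow_succ, mul_assoc]
      gcongr)
    rw [multipass_pairingRound, logSize_pairingRound] at h1
    have h2 := potential_pairingRound_le F
    have h3 : spineLoss F ≤ 32 * logSize F / (i : ℝ) ^ 2 := by
      refine (spineLoss_le_div_sq F hi).trans ?_
      gcongr ?_ / _
      linarith
    have h4 : lossConst * spineLoss F ≤ lossConst * (32 * logSize F / (i : ℝ) ^ 2) := by gcongr
    -- The sum of the `1 / i²` is bounded by telescoping.
    have h5 : 1 / (i : ℝ) ^ 2 ≤ 2 * (1 / i - 1 / (i + 1)) := by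
      rw [div_sub_div _ _ (by positivity) (by positivity), mul_div_assoc',
        div_le_div_iff₀ (by positivity) (by positivity)]
      nlinarith
    have h6 := mul_le_mul_of_nonneg_left h5 (by positivity : 0 ≤ 32 * lossConst * logSize F)
    have e1 : lossConst * (32 * logSize F / (i : ℝ) ^ 2)
        = 32 * lossConst * logSize F * (1 / (i : ℝ) ^ 2) := by ring
    have e2 : 64 * lossConst * logSize F / ((i + 1 : ℕ) : ℝ)
        = 64 * lossConst * logSize F * (1 / (i + 1)) := by push_cast; ring
    have e3 : 64 * lossConst * logSize F / (i : ℝ)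
        = 64 * lossConst * logSize F * (1 / i) := by ring
    rw [e2] at h1
    rw [e3]
    linarith

/-- After `j` rounds, each with the plain loss, `potential_multipass_le_of_few` applies with `i =
1`. -/
theorem potential_multipass_le (F : BinaryTree α) (j : ℕ)
    (hF : 2 * ((numRoots F - 1 : ℕ) : ℝ) ≤ 2 ^ j * logSize F) :
    potential (multipass F) ≤ potential F + (j + 64) * lossConst * logSize F := by
  have hl := le_lossConst
  induction j generalizing F with
  | zero =>
    have := potential_multipass_le_of_few F 1 le_rfl (by simpa using hF)
    simpa using this
  | succ j ih =>
    have h1 := ih (pairingRound F) (by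
      rw [logSize_pairingRound, numRoots_pairingRound]
      have : (2 : ℝ) * ((numRoots F + 1) / 2 - 1 : ℕ) ≤ (numRoots F - 1 : ℕ) := by
        exact_mod_cast (by omega : 2 * ((numRoots F + 1) / 2 - 1) ≤ numRoots F - 1)
      rw [pow_succ] at hF
      linarith)
    rw [multipass_pairingRound, logSize_pairingRound] at h1
    have h2 := potential_pairingRound_le F
    have h3 := mul_le_mul_of_nonneg_left (spineLoss_le_logSize F)
      (by linarith : 0 ≤ lossConst)
    push_cast
    linarith

end Round

theorem numRoots_le_logSize_of_le_one {F : BinaryTree α} (hF : numRoots F ≤ 1) :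
    (numRoots F : ℝ) ≤ logSize F := by
  match F with
  | .nil => simpa [numRoots_nil] using logSize_nonneg (.nil : BinaryTree α)
  | .node x A C =>
    have h1 : (numRoots (.node x A C) : ℝ) ≤ 1 := by exact_mod_cast hF
    refine h1.trans ?_
    rw [logSize, Real.le_logb_iff_rpow_le (by norm_num)
      (by linarith [one_le_extSize_cast (.node x A C)]), extSize_node_cast]
    have := one_le_extSize_cast A
    have := one_le_extSize_cast C
    norm_num
    linarith

theorem potential_multipass_add_le [LinearOrder α] {h H Q : ℝ} {c r : ℕ} (hH : 0 ≤ H)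
    (hr : shrink^[r] h ≤ H) (hQ : lossConst + 2 ^ H ≤ Q) (hc : Q ≤ 2 ^ c)
    (F : BinaryTree α) (hF : logSize F ≤ h) :
    potential (multipass F) + numRoots F / 2 ^ (r + 1)
      ≤ potential F + ((67 + c) * lossConst + Q) * ((r + 1 : ℕ) : ℝ) * logSize F := by
  have hl := le_lossConst
  have hp : (0 : ℝ) ≤ 2 ^ H := by positivity
  have hL1 : (1 : ℝ) ≤ ((r + 1 : ℕ) : ℝ) := by push_cast; linarith [r.cast_nonneg (α := ℝ)]
  induction hk : numRoots F using Nat.strong_induction_on generalizing F with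
  | h k ih =>
    subst hk
    have hn := logSize_nonneg F
    -- In the large case the drop `k / 2^r` is two halves `k / 2^(r+1)`: one is the claimed saving,
    -- the other covers the losses of the `r + 1` rounds. The saving of later phases is discarded.
    by_cases hbig : 2 ≤ numRoots F ∧
        ((r + 1 : ℕ) : ℝ) * Q * logSize F ≤ numRoots F / 2 ^ (r + 1)
    · have h1 := potential_iterate_add_numRoots_le hH hF hr
      have h2 := potential_pairingRound_le (pairingRound^[r] F)
      have h3 := spineLoss_le_logSize (pairingRound^[r] F)
      rw [← Function.iterate_succ_apply' pairingRound] at h2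
      rw [logSize_iterate] at h3
      have h4 := mul_le_mul_of_nonneg_left h3 (by linarith : 0 ≤ lossConst)
      have h5 := ih (numRoots (pairingRound^[r + 1] F)) (by
        rw [Function.iterate_succ_apply', numRoots_pairingRound]
        have := numRoots_iterate_le r F
        omega) (pairingRound^[r + 1] F) (by rwa [logSize_iterate]) rfl
      rw [multipass_iterate, logSize_iterate] at h5
      have h6 : 0 ≤ (numRoots (pairingRound^[r + 1] F) : ℝ) / 2 ^ (r + 1) := by positivity
      have h7 : (r * lossConst + 2 ^ H) * logSize F + lossConst * logSize F
          ≤ ((r + 1 : ℕ) : ℝ) * Q * logSize F := by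
        rw [← add_mul]
        gcongr
        calc r * lossConst + 2 ^ H + lossConst
            ≤ ((r + 1 : ℕ) : ℝ) * lossConst + ((r + 1 : ℕ) : ℝ) * 2 ^ H := by
              have := mul_le_mul_of_nonneg_right hL1 hp
              push_cast at this ⊢
              linarith
          _ ≤ _ := by rw [← mul_add]; gcongr
      have h8 : (numRoots F : ℝ) / 2 ^ r = 2 * (numRoots F / 2 ^ (r + 1)) := by
        rw [pow_succ]; field_simp
      linarith
    · have hQ1 : 1 ≤ Q := by linarith
      have h1 : (numRoots F : ℝ) / 2 ^ (r + 1) ≤ ((r + 1 : ℕ) : ℝ) * Q * logSize F := by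
        by_contra! hcon
        have h2 : numRoots F ≤ 1 := by
          by_contra! h2
          exact hbig ⟨h2, hcon.le⟩
        have h3 := numRoots_le_logSize_of_le_one h2
        have h4 : (numRoots F : ℝ) / 2 ^ (r + 1) ≤ numRoots F :=
          div_le_self (by positivity) (one_le_pow₀ (by norm_num))
        have h5 : 1 * logSize F ≤ ((r + 1 : ℕ) : ℝ) * Q * logSize F := by
          gcongr
          nlinarith
        linarith
      -- The exponent collects `2`, `r + 1 ≤ 2^(r+1)`, `Q ≤ 2^c` and the factor `2^(r+1)`.
      have h2 : 2 * ((numRoots F - 1 : ℕ) : ℝ) ≤ 2 ^ (2 * r + 3 + c) * logSize F := by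
        have h3 : ((numRoots F - 1 : ℕ) : ℝ) ≤ numRoots F := by
          exact_mod_cast Nat.sub_le _ _
        rw [div_le_iff₀ (by positivity)] at h1
        have h4 : ((r + 1 : ℕ) : ℝ) ≤ 2 ^ (r + 1) := by
          exact_mod_cast (Nat.lt_two_pow_self).le
        calc 2 * ((numRoots F - 1 : ℕ) : ℝ)
            ≤ 2 * (((r + 1 : ℕ) : ℝ) * Q * logSize F * 2 ^ (r + 1)) := by linarith
          _ ≤ 2 * (2 ^ (r + 1) * 2 ^ c * logSize F * 2 ^ (r + 1)) := by gcongr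
          _ = _ := by ring
      have h3 := potential_multipass_le F (2 * r + 3 + c) h2
      have h4 : (((2 * r + 3 + c : ℕ) : ℝ) + 64) * lossConst * logSize F
          ≤ (67 + c) * lossConst * ((r + 1 : ℕ) : ℝ) * logSize F := by
        gcongr ?_ * _
        have : ((2 * r + 3 + c : ℕ) : ℝ) + 64 ≤ (67 + c) * ((r + 1 : ℕ) : ℝ) := by
          have h0 := r.cast_nonneg (α := ℝ)
          have h1 := mul_nonneg (c.cast_nonneg (α := ℝ)) h0
          push_cast
          linarith
        calc _ ≤ (67 + c) * ((r + 1 : ℕ) : ℝ) * lossConst := by gcongr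
          _ = _ := by ring
      linarith

/-! ### The iterated logarithm. -/

theorem exists_iterate_logb_le_one (n : ℕ) (x : ℝ) (hx : x ≤ n) :
    ∃ i, (logb 2)^[i] x ≤ 1 := by
  induction n generalizing x with
  | zero => exact ⟨0, by simp at hx; simp; linarith⟩
  | succ n ih =>
    by_cases h2 : x ≤ 2
    · by_cases h1 : x ≤ 1
      · exact ⟨0, h1⟩
      · refine ⟨1, ?_⟩
        rw [Function.iterate_one, Real.logb_le_iff_le_rpow (by norm_num) (by linarith)]
        simpa using h2
    · obtain ⟨i, hi⟩ := ih (logb 2 x) (by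
        refine le_trans ?_ (by push_cast at hx; linarith : x - 1 ≤ n)
        rw [Real.logb_le_iff_le_rpow (by norm_num) (by linarith)]
        have := one_add_mul_self_le_rpow_one_add (s := 1) (by norm_num)
          (by linarith : 1 ≤ x - 1)
        norm_num at this
        exact this)
      exact ⟨i + 1, by rwa [Function.iterate_succ_apply]⟩

theorem iterate_logStar_le_one (x : ℝ) : (logb 2)^[logStar x] x ≤ 1 := by
  obtain ⟨n, hn⟩ := exists_nat_ge x
  exact Nat.sInf_mem (s := {i : ℕ | (logb 2)^[i] x ≤ 1}) (exists_iterate_logb_le_one n x hn)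

theorem one_lt_iterate_of_lt_logStar {x : ℝ} {i : ℕ} (hi : i < logStar x) :
    1 < (logb 2)^[i] x :=
  not_le.1 (Nat.notMem_of_lt_sInf (s := {i : ℕ | (logb 2)^[i] x ≤ 1}) hi)

theorem logStar_mono {x y : ℝ} (hxy : x ≤ y) : logStar x ≤ logStar y := by
  by_contra! h
  have key : ∀ i, i ≤ logStar y → (logb 2)^[i] x ≤ (logb 2)^[i] y := by
    intro i hi
    induction i with
    | zero => exact hxy
    | succ i ih =>
      rw [Function.iterate_succ_apply', Function.iterate_succ_apply']
      exact logb_two_mono (by linarith [one_lt_iterate_of_lt_logStar (by omega : i < logStar x)])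
        (ih (by omega))
  linarith [key _ le_rfl, one_lt_iterate_of_lt_logStar h, iterate_logStar_le_one y]

theorem shrink_mono {x y : ℝ} (hx : 0 ≤ x) (hxy : x ≤ y) : shrink x ≤ shrink y := by
  have h1 := one_le_logb_two_add hx
  have h2 : logb 2 (2 + x) ≤ logb 2 (2 + y) := logb_two_mono (by linarith) (by linarith)
  unfold shrink
  gcongr

theorem shrink_iterate_le {x : ℝ} {r : ℕ}
    (hr : ∀ i, 1 ≤ i → i ≤ r → 1 ≤ (logb 2)^[i] x) :
    shrink^[r] (1024 * (3 + logb 2 x) ^ 2) ≤ 1024 * (3 + (logb 2)^[r + 1] x) ^ 2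
      ∧ 0 ≤ shrink^[r] (1024 * (3 + logb 2 x) ^ 2) := by
  induction r with
  | zero => exact ⟨le_rfl, by simp only [Function.iterate_zero, id]; positivity⟩
  | succ r ih =>
    obtain ⟨h1, h0⟩ := ih fun i hi hir => hr i hi (by omega)
    rw [Function.iterate_succ_apply', Function.iterate_succ_apply' (logb 2)]
    exact ⟨(shrink_mono h0 h1).trans (shrink_le (hr (r + 1) (by omega) le_rfl)),
      by linarith [two_le_shrink (shrink^[r] (1024 * (3 + logb 2 x) ^ 2))]⟩

/-- After `r` steps the parameter is the last iterate, which lies in `[0, 1]`, and `16384 = 1024 ·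
4²`. -/
theorem shrink_iterate_logStar_le {x : ℝ} {r : ℕ} (hr : logStar x = r + 1) :
    shrink^[r] (1024 * (3 + logb 2 x) ^ 2) ≤ 16384 := by
  refine (shrink_iterate_le fun i _ hi => (one_lt_iterate_of_lt_logStar (by omega)).le).1.trans ?_
  have h1 : (logb 2)^[r + 1] x ≤ 1 := hr ▸ iterate_logStar_le_one x
  have h0 : 0 ≤ (logb 2)^[r + 1] x := by
    rw [Function.iterate_succ_apply']
    exact Real.logb_nonneg (by norm_num) (one_lt_iterate_of_lt_logStar (by omega)).le
  nlinarith

/-! ### The amortized bound and sequences of operations. -/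

theorem rate_nonneg (n : ℕ) : 0 ≤ rate n := by
  have : 0 ≤ logb 2 (n : ℝ) := by
    rcases Nat.eq_zero_or_pos n with rfl | h
    · simp
    · exact Real.logb_nonneg (by norm_num) (by exact_mod_cast h)
  unfold rate
  positivity

theorem numNodes_multipass [LinearOrder α] (F : BinaryTree α) :
    (multipass F).numNodes = F.numNodes := by
  have := extSize_multipass F
  simp only [extSize_eq] at this
  omega

theorem logSize_le_two_mul_logb (F : BinaryTree α) :
    logSize F ≤ 2 * logb 2 ((F.numNodes + 1 : ℕ) : ℝ) := by
  have h2 : 2 * logb 2 ((F.numNodes + 1 : ℕ) : ℝ) = logb 2 (((F.numNodes + 1 : ℕ) : ℝ) ^ 2) := by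
    rw [Real.logb_pow]; norm_num
  rw [h2]
  apply logb_two_mono (by linarith [one_le_extSize_cast F])
  rw [extSize_eq]
  exact_mod_cast (by nlinarith : 2 * F.numNodes + 1 ≤ (F.numNodes + 1) ^ 2)

theorem potential_le_potential_node (x : α) (A C : BinaryTree α) :
    potential A ≤ potential (.node x A C) := by
  have h1 := nodePotential_nonneg (s := extSize (.node x A C)) (one_le_extSize A)
    (by simp only [extSize]; omega)
  have h2 := nodePotential_nonneg (s := extSize (.node x A C)) (one_le_extSize C)
    (by simp only [extSize]; omega)
  have h3 := potential_nonneg C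
  simp only [potential]
  linarith

theorem exists_amortizedTime_le :
    ∃ C : ℝ, 0 < C ∧ ∀ (α : Type u) [LinearOrder α] (T : BinaryTree α), numRoots T ≤ 1 →
      1 ≤ T.numNodes → amortizedTime (scaledPotential 1) T ≤ C * rate T.numNodes := by
  obtain ⟨c, hc⟩ := pow_unbounded_of_one_lt (lossConst + 2 ^ (16384 : ℝ)) (one_lt_two (α := ℝ))
  set A : ℝ := (67 + c) * lossConst + (lossConst + 2 ^ (16384 : ℝ)) with hA
  have hA0 : 0 < A := by
    have := le_lossConst
    positivity
  clear_value A
  refine ⟨2 * A, by positivity, fun α _ T hT hn => ?_⟩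
  match T with
  | .node x F (.node _ _ _) => simp [numRoots_node] at hT
  | .node x F .nil =>
    have hpot := potential_le_potential_node x F .nil
    have hdel : deleteMin (.node x F .nil) = multipass F := rfl
    have hcost : deleteMinCost (.node x F .nil) = numRoots F := rfl
    have hnum : (BinaryTree.node x F .nil).numNodes = F.numNodes + 1 := by
      simp [BinaryTree.numNodes]
    have hstar : logStar (F.numNodes : ℝ) ≤ logStar ((F.numNodes + 1 : ℕ) : ℝ) :=
      logStar_mono (by push_cast; linarith)
    rw [amortizedTime, scaledPotential, scaledPotential, hdel, hcost, hnum, numNodes_multipass]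
    have hpm := potential_nonneg (multipass F)
    -- The scale factor belongs to a smaller heap after the deletion; monotonicity of `logStar` lets
    -- the old factor be used throughout.
    have hscale : (2 : ℝ) ^ logStar (F.numNodes : ℝ) * potential (multipass F)
        ≤ 2 ^ logStar ((F.numNodes + 1 : ℕ) : ℝ) * potential (multipass F) := by
      gcongr
      norm_num
    -- For a single node `log* 1 = 0`, so it cannot be written as `r + 1`; there the cost and the
    -- new potential vanish.
    rcases Nat.eq_zero_or_pos F.numNodes with h0 | h0
    · have hF : F = .nil := by
        cases F with
        | nil => rfl
        | node => simp [BinaryTree.numNodes] at h0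
      subst hF
      have h1 : multipass (.nil : BinaryTree α) = .nil := multipass_eq_self (by simp [numRoots_nil])
      have h2 := mul_nonneg hA0.le (rate_nonneg ((BinaryTree.nil : BinaryTree α).numNodes + 1))
      have h3 : 0 ≤ (2 : ℝ) ^ logStar (((BinaryTree.nil : BinaryTree α).numNodes + 1 : ℕ) : ℝ)
          * potential (.node x .nil .nil) := mul_nonneg (by positivity) (potential_nonneg _)
      rw [h1, numRoots_nil]
      simp only [potential, mul_zero, Nat.cast_zero, one_mul] at h3 ⊢
      linarith
    · have hsize := logSize_le_two_mul_logb F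
      set n := F.numNodes + 1 with hndef
      have hn2 : (2 : ℝ) ≤ n := by exact_mod_cast (by omega : 2 ≤ n)
      obtain ⟨r, hr⟩ : ∃ r, logStar (n : ℝ) = r + 1 := by
        refine Nat.exists_eq_succ_of_ne_zero fun h => ?_
        have := iterate_logStar_le_one (n : ℝ)
        rw [h] at this
        simp only [Function.iterate_zero, id] at this
        linarith
      have hlog : 0 ≤ logb 2 (n : ℝ) := Real.logb_nonneg (by norm_num) (by linarith)
      -- The starting threshold `1024 (3 + log n)²` exceeds `2 log n`, hence the log-size.
      have key := potential_multipass_add_le (F := F) (by norm_num : (0 : ℝ) ≤ 16384)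
        (shrink_iterate_logStar_le hr) le_rfl hc.le (hsize.trans (by nlinarith))
      rw [← hA] at key
      have h1 : A * ((r + 1 : ℕ) : ℝ) * logSize F
          ≤ A * ((r + 1 : ℕ) : ℝ) * (2 * logb 2 (n : ℝ)) := by gcongr
      have h2 := mul_le_mul_of_nonneg_left (key.trans (add_le_add hpot h1))
        (by positivity : (0 : ℝ) ≤ 2 ^ (r + 1))
      rw [mul_add, mul_div_cancel₀ _ (by positivity)] at h2
      rw [hr] at hscale
      rw [rate, hr, one_mul, one_mul]
      linarith

theorem numRoots_deleteMin_le [LinearOrder α] (T : BinaryTree α) :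
    numRoots (deleteMin T) ≤ 1 := by
  cases T with
  | nil => simp [deleteMin, numRoots_nil]
  | node x F C => exact numRoots_multipass_le F

theorem numNodes_deleteMin [LinearOrder α] {T : BinaryTree α} (hT : numRoots T ≤ 1) :
    (deleteMin T).numNodes = T.numNodes - 1 := by
  match T with
  | .nil => rfl
  | .node x F .nil => simp [deleteMin, numNodes_multipass, BinaryTree.numNodes]
  | .node x F (.node _ _ _) => simp [numRoots_node] at hT

theorem iterate_deleteMin [LinearOrder α] {T : BinaryTree α} (hT : numRoots T ≤ 1) (i : ℕ) :
    numRoots (deleteMin^[i] T) ≤ 1 ∧ (deleteMin^[i] T).numNodes = T.numNodes - i := by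
  induction i with
  | zero => exact ⟨hT, rfl⟩
  | succ i ih =>
    rw [Function.iterate_succ_apply']
    refine ⟨numRoots_deleteMin_le _, ?_⟩
    rw [numNodes_deleteMin ih.1, ih.2]
    omega

theorem sum_deleteMinCost_add_le [LinearOrder α] {Ψ : BinaryTree α → ℝ} {f : ℕ → ℝ}
    (hf : ∀ T : BinaryTree α, numRoots T ≤ 1 → 1 ≤ T.numNodes →
      amortizedTime Ψ T ≤ f T.numNodes)
    {T : BinaryTree α} (hT : numRoots T ≤ 1) (m : ℕ) (hm : m ≤ T.numNodes) :
    ∑ i ∈ Finset.range m, (deleteMinCost (deleteMin^[i] T) : ℝ) + Ψ (deleteMin^[m] T)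
      ≤ Ψ T + ∑ i ∈ Finset.range m, f (T.numNodes - i) := by
  induction m with
  | zero => simp
  | succ m ih =>
    obtain ⟨h1, h2⟩ := iterate_deleteMin hT m
    have h3 := hf _ h1 (by omega)
    rw [amortizedTime, h2, ← Function.iterate_succ_apply' deleteMin] at h3
    rw [Finset.sum_range_succ, Finset.sum_range_succ]
    linarith [ih (by omega)]

end PairingHeap

theorem theorem1 :
    ∃ c C : ℝ, 0 < c ∧ 0 < C ∧
      ∀ (α : Type*) [LinearOrder α] (T : BinaryTree α), PairingHeap.IsPairingHeap T →
        -- the amortized time of one delete-min on a heap with at least one node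
        (1 ≤ T.numNodes →
          PairingHeap.amortizedTime (PairingHeap.scaledPotential c) T
            ≤ C * PairingHeap.rate T.numNodes) ∧
        -- the total real cost of a sequence of `m` delete-min operations that starts from `T`
        (∀ m : ℕ, m ≤ T.numNodes →
          ∑ i ∈ Finset.range m,
              (PairingHeap.deleteMinCost (PairingHeap.deleteMin^[i] T) : ℝ)
            ≤ PairingHeap.scaledPotential c T
              + ∑ i ∈ Finset.range m, C * PairingHeap.rate (T.numNodes - i)) := by
  obtain ⟨C, hC, h⟩ := PairingHeap.exists_amortizedTime_le
  refine ⟨1, C, one_pos, hC, fun α _ T hT => ⟨h α T hT.2, fun m hm => ?_⟩⟩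
  have h1 := PairingHeap.sum_deleteMinCost_add_le (f := fun n => C * PairingHeap.rate n)
    (h α) hT.2 m hm
  have h2 : 0 ≤ PairingHeap.scaledPotential 1 (PairingHeap.deleteMin^[m] T) :=
    mul_nonneg (by positivity) (PairingHeap.potential_nonneg _)
  linarith
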